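/- **Setting.** For a diffeological space $X$, $\Omega^1(X)$ is the vector space of differential $1$-forms on $X$ (assignments $p\mapsto\omega(p)$ of a smooth $1$-form on the domain of each plot $p$, with $\omega(p\circ F)=F^*(\omega(p))$ for smooth $F$), with its functional diffeology: $q:U'\to\Omega^1(X)$ is a plot iff $(u',u)\mapsto q(u')(p)(u)$ is smooth for every plot $p$ of $X$. For $x\in X$ let $\Lambda^1_x(X)=\Omega^1(X)/\Omega^1_x(X)$, where $\Omega^1_x(X)$ consists of the forms $\omega$ with $\omega(p)(0)=0$ for all plots $p$ with $p(0)=x$; $\omega_x\in\Lambda^1_x(X)$ is the class of $\omega$. Then $\Lambda^1(X)=\coprod_{x}\Lambda^1_x(X)$ carries the pushforward of the product diffeology by $X\times\Omega^1(X)\to\Lambda^1(X)$, $(x,\omega)\mapsto(x,\omega_x)$. For a diffeological vector pseudo-bundle $V\to X$, $V_x^*$ is the space of smooth linear functionals on the fibre $V_x$, and $V^*=\coprod_x V_x^*$, where a map $u\mapsto(x(u),a(u))$ is a plot iff $x$ is a plot of $X$ and the evaluation $a(u)(v)$ is smooth along the plots of $V$ lying over $x$. The fibre of $V^*\otimes V^*$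 at $x$ is $V_x^*\otimes V_x^*$, regarded as bilinear forms on $V_x$, and $V^*\otimes V^*$ carries one of the following two diffeologies, the same one throughout: (a) the tensor product diffeology, whose plots are locally of the form $u\mapsto\sum_{i=1}^k a_i(u)\otimes b_i(u)$ with $a_i,b_i$ plots of $V^*$ over the same plot of $X$; or (b) the functional diffeology, in which $u\mapsto(x(u),\tau(u))$ is a plot iff $x$ is a plot of $X$ and $\tau(u)(v,w)$ is smooth along pairs of plots of $V$ lying over $x$. A *pseudo-metric* on $V$ is a smooth section $g:X\to V^*\otimes V^*$, where all $V_x$ are finite-dimensional, such that each $g(x)$ is a symmetric positive semidefinite bilinear form on $V_x$ of rank $\dim V_x^*$. Let $X_1,X_2$ be diffeological spaces, $Y\subseteq X_1$, and let $f:Y\to X_2$ be a diffeomorphism onto its image (for the subset diffeologies). Let $X_1\cup_f X_2=(X_1\sqcup X_2)/(y\sim f(y))$ with the quotient diffeology, and let $i_1:X_1\to X_1\cup_f X_2$, $i_2:X_2\to X_1\cup_f X_2$ be the natural maps. Let $i:Y\hookrightarrow X_1$ and $j:f(Y)\hookrightarrow X_2$ be the inclusions, and let $\mathcal D_1^\Omega$,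 $\mathcal D_2^\Omega$ be the pushforward diffeologies on $\Omega^1(Y)$ of those of $\Omega^1(X_1)$ and $\Omega^1(X_2)$ by $i^*$ and $f^*j^*$, respectively. Restriction of forms gives maps $\tilde\rho_1^\Lambda:\Lambda^1_{i_1(x_1)}(X_1\cup_f X_2)\to\Lambda^1_{x_1}(X_1)$, $\omega_{i_1(x_1)}\mapsto(i_1^*\omega)_{x_1}$, and, in the same way, $\tilde\rho_2^\Lambda:\Lambda^1_{i_2(x_2)}(X_1\cup_f X_2)\to\Lambda^1_{x_2}(X_2)$. Forms $\omega_1\in\Omega^1(X_1)$, $\omega_2\in\Omega^1(X_2)$ are *compatible* if $\omega_1(p)=\omega_2(f\circ p)$ for every plot $p$ of $Y$. Elements $\alpha_1\in\Lambda^1_y(X_1)$, $\alpha_2\in\Lambda^1_{f(y)}(X_2)$, $y\in Y$, are *compatible* if $\alpha_1=(\omega_1)_y$ and $\alpha_2=(\omega_2)_{f(y)}$ for some compatible forms $\omega_1,\omega_2$. Pseudo-metrics $g_1^\Lambda$ on $\Lambda^1(X_1)$ and $g_2^\Lambda$ on $\Lambda^1(X_2)$ are *compatible* if $g_1^\Lambda(y)(\alpha_1,\beta_1)=g_2^\Lambda(f(y))(\alpha_2,\beta_2)$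 for all $y\in Y$ and all compatible pairs $(\alpha_1,\alpha_2)$, $(\beta_1,\beta_2)$ in $\Lambda^1_y(X_1)\times\Lambda^1_{f(y)}(X_2)$. **Theorem.** Suppose that $\mathcal D_1^\Omega=\mathcal D_2^\Omega$. 1. Let $g_1^\Lambda$, $g_2^\Lambda$ be compatible pseudo-metrics on $\Lambda^1(X_1)$ and $\Lambda^1(X_2)$. Then the section $g^\Lambda$ defined by $$g^\Lambda(x)(\cdot,\cdot)=\begin{cases} g_1^\Lambda(x_1)(\tilde\rho_1^\Lambda\cdot,\tilde\rho_1^\Lambda\cdot), & x=i_1(x_1),\ x_1\in X_1\setminus Y,\\ g_2^\Lambda(x_2)(\tilde\rho_2^\Lambda\cdot,\tilde\rho_2^\Lambda\cdot), & x=i_2(x_2),\ x_2\in X_2\setminus f(Y),\\ \tfrac12\big(g_1^\Lambda(y)(\tilde\rho_1^\Lambda\cdot,\tilde\rho_1^\Lambda\cdot)+g_2^\Lambda(f(y))(\tilde\rho_2^\Lambda\cdot,\tilde\rho_2^\Lambda\cdot)\big), & x=i_2(f(y)),\ y\in Y,\end{cases}$$ is a pseudo-metric on $\Lambda^1(X_1\cup_f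 X_2)$. 2. Consequently, if $\Lambda^1(X_1)$ and $\Lambda^1(X_2)$ admit compatible pseudo-metrics, then $\Lambda^1(X_1\cup_f X_2)$ admits a pseudo-metric. -/

import Mathlib

noncomputable section

open Diffeology Topology Filter
open scoped ContDiff TensorProduct

namespace GluedForms

/-- The Euclidean space `ℝⁿ`, the domain of the plots of a diffeology. -/
abbrev Eu (n : ℕ) : Type := EuclideanSpace ℝ (Fin n)

/-- Any open neighbourhood of a point contains the range of a smooth map which is the identity
near that point. -/
theorem exists_smooth_cutoff {n : ℕ} {u : Set (Eu n)} (hu : IsOpen u) {x : Eu n} (hx : x ∈ u) :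
    ∃ r : Eu n → Eu n, ContDiff ℝ ∞ r ∧ (∀ y, r y ∈ u) ∧ ∀ᶠ y in 𝓝 x, r y = y := by
  obtain ⟨ε, hε, hb⟩ := Metric.isOpen_iff.mp hu x hx
  let χ : ContDiffBump x := ⟨ε / 2, ε, by positivity, by linarith⟩
  refine ⟨fun y => x + χ y • (y - x), ?_, fun y => hb ?_, ?_⟩
  · exact contDiff_const.add (χ.contDiff.smul (contDiff_id.sub contDiff_const))
  · rw [Metric.mem_ball, dist_eq_norm, add_sub_cancel_left, norm_smul, Real.norm_eq_abs,
      abs_of_nonneg χ.nonneg]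
    by_cases hy : y ∈ Metric.ball x ε
    · calc χ y * ‖y - x‖ ≤ 1 * ‖y - x‖ := by gcongr; exact χ.le_one
        _ < ε := by rw [one_mul, ← dist_eq_norm]; exact hy
    · rw [χ.zero_of_le_dist (by simpa using hy)]
      simpa using hε
  · filter_upwards [χ.eventuallyEq_one] with y hy
    simp only [Pi.one_apply] at hy
    simp [hy]

/-! ### Constructions of diffeologies -/

/-- The finest diffeology containing a family `G` of maps that is stable under smooth
substitutions: its plots are the maps that are, locally, constant or members of `G`. -/
@[reducible]
def localClosure {X : Type*} (G : ∀ n : ℕ, Set (Eu n → X))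
    (hG : ∀ {n m : ℕ} {q : Eu m → X} {h : Eu n → Eu m},
      q ∈ G m → ContDiff ℝ ∞ h → q ∘ h ∈ G n) : DiffeologicalSpace X where
  plots n := {p | ∀ u, (∃ q ∈ G n, p =ᶠ[𝓝 u] q) ∨ ∃ x : X, p =ᶠ[𝓝 u] fun _ => x}
  constant_plots x := fun _ => Or.inr ⟨x, EventuallyEq.rfl⟩
  plot_reparam := fun hp hh u => by
    rcases hp _ with ⟨q, hq, e⟩ | ⟨x, e⟩
    · exact Or.inl ⟨_, hG hq hh, e.comp_tendsto hh.continuous.continuousAt⟩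
    · exact Or.inr ⟨x, e.comp_tendsto hh.continuous.continuousAt⟩
  locality := fun {n p} hp u => by
    obtain ⟨s, hs, hus, h⟩ := hp u
    obtain ⟨r, hr, hrs, hru⟩ := exists_smooth_cutoff hs hus
    have e : p =ᶠ[𝓝 u] p ∘ r := by
      filter_upwards [hru] with y hy
      simp [hy]
    rcases h hrs hr u with ⟨q, hq, e'⟩ | ⟨x, e'⟩
    · exact Or.inl ⟨q, hq, e.trans e'⟩
    · exact Or.inr ⟨x, e.trans e'⟩

/-- The pullback diffeology: the plots are the maps whose composition with `f` is a plot. -/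
@[reducible]
def pullbackDiffeology {X Y : Type*} (f : X → Y) (d : DiffeologicalSpace Y) :
    DiffeologicalSpace X where
  plots _ := {p | IsPlot (f ∘ p)}
  constant_plots x := isPlot_const (x := f x)
  plot_reparam := fun {_ _ p _} hp hh => isPlot_reparam (p := f ∘ p) hp hh
  locality := fun hp => d.locality hp

/-- The pushforward diffeology: the plots are the maps that are, locally, compositions of `f` with
a plot (or constant, which only matters outside of the range of `f`). -/
@[reducible]
def pushforwardDiffeology {X Y : Type*} (f : X → Y) (d : DiffeologicalSpace X) :
    DiffeologicalSpace Y :=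
  localClosure (fun _ => {q | ∃ p, IsPlot p ∧ q = f ∘ p}) (by
    rintro n m _ h ⟨p, hp, rfl⟩ hh
    exact ⟨p ∘ h, isPlot_reparam hp hh, rfl⟩)

set_option linter.unusedSectionVars false

variable {X Y : Type*} [DiffeologicalSpace X] [DiffeologicalSpace Y]

/-- The subset diffeology. -/
instance subsetDiffeology (s : Set X) : DiffeologicalSpace s :=
  pullbackDiffeology Subtype.val inferInstance

/-- The product diffeology. -/
instance prodDiffeology : DiffeologicalSpace (X × Y) :=
  pullbackDiffeology Prod.fst inferInstance ⊓ pullbackDiffeology Prod.snd inferInstance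

/-- The disjoint union diffeology: the plots are, locally, plots of `X` or plots of `Y`. -/
instance sumDiffeology : DiffeologicalSpace (X ⊕ Y) :=
  localClosure (fun _ => {q | (∃ p : _ → X, IsPlot p ∧ q = Sum.inl ∘ p) ∨
      ∃ p : _ → Y, IsPlot p ∧ q = Sum.inr ∘ p}) (by
    rintro n m _ h (⟨p, hp, rfl⟩ | ⟨p, hp, rfl⟩) hh
    · exact Or.inl ⟨p ∘ h, isPlot_reparam hp hh, rfl⟩
    · exact Or.inr ⟨p ∘ h, isPlot_reparam hp hh, rfl⟩)

/-! ### Differential 1-forms -/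

/-- The plots of `X` with domain `ℝⁿ`. -/
def Plot (X : Type*) [DiffeologicalSpace X] (n : ℕ) : Type _ := {p : Eu n → X // IsPlot p}

/-- Substitution of a smooth map into a plot. -/
def Plot.reparam {n m : ℕ} (p : Plot X m) (F : Eu n → Eu m) (hF : ContDiff ℝ ∞ F) : Plot X n :=
  ⟨p.1 ∘ F, isPlot_reparam p.2 hF⟩

/-- Composition of a plot with a smooth map. -/
def Plot.map {n : ℕ} (p : Plot X n) (h : X → Y) (hh : DSmooth h) : Plot Y n :=
  ⟨h ∘ p.1, hh n p.1 p.2⟩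

/-- The assignments that send a plot `p : ℝⁿ → X` to a map `ℝⁿ → (ℝⁿ)*`. -/
abbrev PreForm (X : Type*) [DiffeologicalSpace X] : Type _ :=
  ∀ n : ℕ, Plot X n → Eu n → (Eu n →L[ℝ] ℝ)

/-- The defining properties of a differential 1-form `θ` on `X`: the `θ(p)` are smooth 1-forms on
`ℝⁿ`, and `θ(p ∘ F) = F^*(θ(p))`. -/
structure IsForm (θ : PreForm X) : Prop where
  smooth : ∀ n (p : Plot X n), ContDiff ℝ ∞ (θ n p)
  compat : ∀ (n m : ℕ) (p : Plot X m) (F : Eu n → Eu m) (hF : ContDiff ℝ ∞ F) (u : Eu n),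
    θ n (p.reparam F hF) u = (θ m p (F u)).comp (fderiv ℝ F u)

/-- The differential 1-forms on `X`, as a subspace of the space of all assignments. -/
def formSubmodule (X : Type*) [DiffeologicalSpace X] : Submodule ℝ (PreForm X) where
  carrier := {θ | IsForm θ}
  zero_mem' := ⟨fun _ _ => contDiff_const, fun _ _ _ _ _ _ => by simp⟩
  add_mem' := fun ha hb => ⟨fun n p => (ha.1 n p).add (hb.1 n p), fun n m p F hF u => by
    simp [ha.2 n m p F hF u, hb.2 n m p F hF u]⟩
  smul_mem' := fun c _ ha => ⟨fun n p => (ha.1 n p).const_smul c, fun n m p F hF u => by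
    simp [ha.2 n m p F hF u]⟩

/-- The vector space `Ω¹(X)` of differential 1-forms on a diffeological space `X`. -/
def Form (X : Type*) [DiffeologicalSpace X] : Type _ := formSubmodule X

instance : AddCommGroup (Form X) := inferInstanceAs (AddCommGroup (formSubmodule X))

instance : Module ℝ (Form X) := inferInstanceAs (Module ℝ (formSubmodule X))

/-- The 1-form `θ(p)` on `ℝⁿ` assigned by `θ` to the plot `p`. -/
def Form.eval (θ : Form X) {n : ℕ} (p : Plot X n) : Eu n → (Eu n →L[ℝ] ℝ) := θ.1 n p

theorem Form.isForm (θ : Form X) : IsForm θ.1 := θ.2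

/-- The functional diffeology on `Ω¹(X)`. -/
instance formDiffeology : DiffeologicalSpace (Form X) where
  plots m := {q | ∀ (n : ℕ) (p : Plot X n),
    ContDiff ℝ ∞ fun z : Eu m × Eu n => (q z.1).eval p z.2}
  constant_plots θ := fun n p => (θ.isForm.smooth n p).comp contDiff_snd
  plot_reparam := fun {a b q F} hq hF n p => by
    exact (hq n p).comp ((hF.comp contDiff_fst).prodMk contDiff_snd)
  locality := fun {a q} hq n p => by
    rw [contDiff_iff_contDiffAt]
    rintro ⟨u, t⟩
    obtain ⟨s, hs, hus, h⟩ := hq u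
    obtain ⟨r, hr, hrs, hru⟩ := exists_smooth_cutoff hs hus
    have h1 := (h hrs hr n p).contDiffAt (x := (u, t))
    refine h1.congr_of_eventuallyEq ?_
    have h2 : ∀ᶠ z : Eu a × Eu n in 𝓝 (u, t), r z.1 = z.1 :=
      (continuous_fst.tendsto (u, t)).eventually hru
    filter_upwards [h2] with z hz
    simp [hz]

/-- The pullback `h^* : Ω¹(Y) → Ω¹(X)` by a smooth map `h : X → Y`, `(h^*θ)(p) = θ(h ∘ p)`. -/
def pullback (h : X → Y) (hh : DSmooth h) : Form Y →ₗ[ℝ] Form X where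
  toFun θ := ⟨fun n p => θ.eval (p.map h hh),
    (⟨fun n p => θ.isForm.smooth n (p.map h hh),
      fun n m p F hF u => θ.isForm.compat n m (p.map h hh) F hF u⟩ : IsForm _)⟩
  map_add' _ _ := rfl
  map_smul' _ _ := rfl

/-- The 1-forms on `X` that vanish at `x`: `θ(p)(0) = 0` for all plots `p` centered at `x`. -/
def vanishingForms (X : Type*) [DiffeologicalSpace X] (x : X) : Submodule ℝ (Form X) where
  carrier := {θ | ∀ (n : ℕ) (p : Plot X n), p.1 0 = x → θ.eval p 0 = 0}
  zero_mem' := fun _ _ _ => rfl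
  add_mem' := fun {a b} ha hb n p hp => by
    change a.eval p 0 + b.eval p 0 = 0
    rw [ha n p hp, hb n p hp, add_zero]
  smul_mem' := fun c a ha n p hp => by
    change c • a.eval p 0 = 0
    rw [ha n p hp, smul_zero]

/-- The space `Λ¹_x(X)` of values of 1-forms at `x`. -/
abbrev LambdaAt (X : Type*) [DiffeologicalSpace X] (x : X) : Type _ := Form X ⧸ vanishingForms X x

/-- The value `θ_x ∈ Λ¹_x(X)` of a 1-form at `x`. -/
def Form.valueAt (θ : Form X) (x : X) : LambdaAt X x := (vanishingForms X x).mkQ θ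

/-- The bundle `Λ¹(X)`, with the pushforward of the product diffeology by
`X × Ω¹(X) → Λ¹(X)`, `(x, θ) ↦ (x, θ_x)`. -/
instance lambdaDiffeology : DiffeologicalSpace (Σ x, LambdaAt X x) :=
  pushforwardDiffeology (fun z : X × Form X => (⟨z.1, z.2.valueAt z.1⟩ : Σ x, LambdaAt X x))
    inferInstance

/-! ### Pseudo-metrics on pseudo-bundles

A pseudo-bundle over `X` is given by its fibres `V x` and a diffeology on `Σ x, V x`. -/

section PseudoBundle

variable (V : X → Type*) [∀ x, AddCommGroup (V x)] [∀ x, Module ℝ (V x)]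
  [DiffeologicalSpace (Σ x, V x)]

/-- The diffeological dual of the fibre `V x`: the linear functionals that are smooth for the
subset diffeology of `V x ⊆ Σ x, V x`. -/
def smoothDual (x : X) : Submodule ℝ (Module.Dual ℝ (V x)) where
  carrier := {φ | @DSmooth (V x) ℝ (pullbackDiffeology (Sigma.mk x) inferInstance) _ φ}
  zero_mem' := fun _ _ _ => isPlot_const (x := (0 : ℝ))
  add_mem' := fun ha hb n p hp => ((ha n p hp).contDiff.add (hb n p hp).contDiff).isPlot
  smul_mem' := fun c φ ha n p hp => by
    have h : ContDiff ℝ ∞ (φ ∘ p) := (ha n p hp).contDiff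
    exact ContDiff.isPlot (p := fun u => c • φ (p u)) (h.const_smul c)

theorem smoothDual_contDiff {x : X} (φ : smoothDual V x) {n : ℕ} {v : Eu n → V x}
    (hv : IsPlot fun t => (⟨x, v t⟩ : Σ x, V x)) : ContDiff ℝ ∞ fun t => φ.1 (v t) := by
  have h : @DSmooth (V x) ℝ (pullbackDiffeology (Sigma.mk x) inferInstance) _ φ.1 := φ.2
  exact (h n v hv).contDiff

/-- The dual pseudo-bundle `V*`: a map `u ↦ (x(u), a(u))` into it is a plot if `x` is a plot of
the base and the evaluation of `a` on the plots of `V` is smooth. -/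
instance dualDiffeology : DiffeologicalSpace (Σ x, smoothDual V x) where
  plots n := {a | IsPlot (fun u => (a u).1) ∧
    ∀ (m : ℕ) (h : Eu m → Eu n), ContDiff ℝ ∞ h → ∀ v : ∀ t, V (a (h t)).1,
      IsPlot (fun t => (⟨_, v t⟩ : Σ x, V x)) →
      ContDiff ℝ ∞ fun t => ((a (h t)).2 : Module.Dual ℝ (V (a (h t)).1)) (v t)}
  constant_plots a := ⟨isPlot_const, fun _ _ _ v hv => smoothDual_contDiff V a.2 hv⟩
  plot_reparam := fun ha hF => ⟨isPlot_reparam ha.1 hF, fun m h hh v hv =>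
    ha.2 m _ (hF.comp hh) v hv⟩
  locality := fun {n a} ha => by
    refine ⟨DiffeologicalSpace.locality fun u => ?_, fun m h hh v hv => ?_⟩
    · obtain ⟨s, hs, hus, H⟩ := ha u
      exact ⟨s, hs, hus, fun hf hf' => (H hf hf').1⟩
    · rw [contDiff_iff_contDiffAt]
      intro t
      obtain ⟨s, hs, hus, H⟩ := ha (h t)
      obtain ⟨r, hr, hrs, hrt⟩ := exists_smooth_cutoff (hs.preimage hh.continuous) hus
      have h1 := (H (f := h ∘ r) hrs (hh.comp hr)).2 m id contDiff_id (fun t => v (r t))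
        (isPlot_reparam hv hr)
      refine h1.contDiffAt.congr_of_eventuallyEq ?_
      filter_upwards [hrt] with y hy
      have key : ∀ z, z = y → ((a (h y)).2 : Module.Dual ℝ (V (a (h y)).1)) (v y) =
          ((a (h z)).2 : Module.Dual ℝ (V (a (h z)).1)) (v z) := by
        rintro z rfl
        rfl
      exact key _ hy

/-- The fibre `(V x)* ⊗ (V x)*` of `V* ⊗ V*`. -/
abbrev DualTensorAt (x : X) : Type _ := smoothDual V x ⊗[ℝ] smoothDual V x

variable {V} in
/-- The bilinear form on `V x` given by an element of `(V x)* ⊗ (V x)*`: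
`(a ⊗ b)(v, w) = a(v) b(w)`. -/
def toBilin {x : X} : DualTensorAt V x →ₗ[ℝ] V x →ₗ[ℝ] V x →ₗ[ℝ] ℝ :=
  TensorProduct.lift (LinearMap.mk₂ ℝ (fun a b => a.1.smulRight b.1)
    (fun _ _ _ => by ext; simp [add_mul]) (fun _ _ _ => by ext; simp [mul_assoc])
    (fun _ _ _ => by ext; simp) (fun _ _ _ => by ext; simp [mul_left_comm]))

variable {V} in
@[simp]
theorem toBilin_tmul {x : X} (a b : smoothDual V x) (v w : V x) :
    toBilin (a ⊗ₜ[ℝ] b) v w = a.1 v * b.1 w := by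
  simp [toBilin]

/-- The tensor product diffeology on `V* ⊗ V*`: the plots are, locally, finite sums
`u ↦ ∑ aᵢ(u) ⊗ bᵢ(u)`, where the `aᵢ` and `bᵢ` are plots of `V*` over the same plot of `X`. -/
@[reducible]
def tensorDiffeology : DiffeologicalSpace (Σ x, DualTensorAt V x) :=
  localClosure (fun n => {τ | ∃ (x : Eu n → X) (k : ℕ) (a b : Fin k → ∀ u, smoothDual V (x u)),
      IsPlot x ∧
      (∀ i, IsPlot fun u => (⟨x u, a i u⟩ : Σ x, smoothDual V x)) ∧
      (∀ i, IsPlot fun u => (⟨x u, b i u⟩ : Σ x, smoothDual V x)) ∧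
      τ = fun u => ⟨x u, ∑ i, a i u ⊗ₜ[ℝ] b i u⟩}) (by
    rintro n m _ h ⟨x, k, a, b, hx, ha, hb, rfl⟩ hh
    exact ⟨x ∘ h, k, fun i u => a i (h u), fun i u => b i (h u), isPlot_reparam hx hh,
      fun i => isPlot_reparam (ha i) hh, fun i => isPlot_reparam (hb i) hh, rfl⟩)

/-- The smoothness of the bilinear form on a fibre given by an element of `(V x)* ⊗ (V x)*`. -/
theorem toBilin_contDiff {x : X} (τ : DualTensorAt V x) {n : ℕ} {v w : Eu n → V x}
    (hv : IsPlot fun t => (⟨x, v t⟩ : Σ x, V x)) (hw : IsPlot fun t => (⟨x, w t⟩ : Σ x, V x)) :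
    ContDiff ℝ ∞ fun t => toBilin τ (v t) (w t) := by
  induction τ using TensorProduct.induction_on with
  | zero => simpa using contDiff_const
  | tmul a b =>
    simp only [toBilin_tmul]
    exact (smoothDual_contDiff V a hv).mul (smoothDual_contDiff V b hw)
  | add a b ha hb => simpa using ha.add hb

/-- The functional diffeology on `V* ⊗ V*`, seen as the bundle of smooth bilinear forms on the
fibres of `V`: a map `u ↦ (x(u), τ(u))` is a plot if `x` is a plot of the base and the evaluation
of `τ` on pairs of plots of `V` (lying over the same points) is smooth. -/
@[reducible]
def functionalDiffeology : DiffeologicalSpace (Σ x, DualTensorAt V x) where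
  plots n := {τ | IsPlot (fun u => (τ u).1) ∧
    ∀ (m : ℕ) (h : Eu m → Eu n), ContDiff ℝ ∞ h → ∀ v w : ∀ t, V (τ (h t)).1,
      IsPlot (fun t => (⟨_, v t⟩ : Σ x, V x)) → IsPlot (fun t => (⟨_, w t⟩ : Σ x, V x)) →
      ContDiff ℝ ∞ fun t => toBilin (τ (h t)).2 (v t) (w t)}
  constant_plots τ := ⟨isPlot_const, fun _ _ _ _ _ hv hw => toBilin_contDiff V τ.2 hv hw⟩
  plot_reparam := fun ha hF => ⟨isPlot_reparam ha.1 hF, fun m h hh v w hv hw =>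
    ha.2 m _ (hF.comp hh) v w hv hw⟩
  locality := fun {n a} ha => by
    refine ⟨DiffeologicalSpace.locality fun u => ?_, fun m h hh v w hv hw => ?_⟩
    · obtain ⟨s, hs, hus, H⟩ := ha u
      exact ⟨s, hs, hus, fun hf hf' => (H hf hf').1⟩
    · rw [contDiff_iff_contDiffAt]
      intro t
      obtain ⟨s, hs, hus, H⟩ := ha (h t)
      obtain ⟨r, hr, hrs, hrt⟩ := exists_smooth_cutoff (hs.preimage hh.continuous) hus
      have h1 := (H (f := h ∘ r) hrs (hh.comp hr)).2 m id contDiff_id (fun t => v (r t))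
        (fun t => w (r t)) (isPlot_reparam hv hr) (isPlot_reparam hw hr)
      refine h1.contDiffAt.congr_of_eventuallyEq ?_
      filter_upwards [hrt] with y hy
      have key : ∀ z, z = y →
          toBilin (a (h y)).2 (v y) (w y) = toBilin (a (h z)).2 (v z) (w z) := by
        rintro z rfl
        rfl
      exact key _ hy

/-- The two diffeologies in use on `V* ⊗ V*`. -/
inductive TensorKind
  | tensor
  | functional

/-- The diffeology on `V* ⊗ V*` of the given kind. -/
@[reducible]
def dualTensorDiffeology : TensorKind → DiffeologicalSpace (Σ x, DualTensorAt V x)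
  | .tensor => tensorDiffeology V
  | .functional => functionalDiffeology V

variable {V} in
/-- A pseudo-metric on a pseudo-bundle `V` with finite-dimensional fibres: a smooth section `g` of
`V* ⊗ V*` whose value at each `x` is a symmetric positive semidefinite form on `V x` of rank
`dim (V x)*`. (The values are smooth on the fibres, being elements of `(V x)* ⊗ (V x)*`.) -/
structure IsPseudoMetric (κ : TensorKind) (g : ∀ x, DualTensorAt V x) : Prop where
  finite_dim : ∀ x, FiniteDimensional ℝ (V x)
  smooth : @DSmooth X (Σ x, DualTensorAt V x) _ (dualTensorDiffeology V κ) fun x => ⟨x, g x⟩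
  symm : ∀ x v w, toBilin (g x) v w = toBilin (g x) w v
  nonneg : ∀ x v, 0 ≤ toBilin (g x) v v
  rank_eq : ∀ x, Module.finrank ℝ (LinearMap.range (toBilin (g x))) =
    Module.finrank ℝ (smoothDual V x)

end PseudoBundle

/-! ### Maps induced on the fibres of `Λ¹` -/

/-- For `h : X → Y` smooth and `h x = y`, the map `Λ¹_y(Y) → Λ¹_x(X)`, `θ_y ↦ (h^*θ)_x`. -/
def lambdaMap (h : X → Y) (hh : DSmooth h) {x : X} {y : Y} (hxy : h x = y) :
    LambdaAt Y y →ₗ[ℝ] LambdaAt X x :=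
  Submodule.mapQ (vanishingForms Y y) (vanishingForms X x) (pullback h hh) <| by
    intro θ hθ n p hp
    exact (show ∀ n (p : Plot Y n), p.1 0 = y → θ.eval p 0 = 0 from hθ) n (p.map h hh)
      (by rw [← hxy, ← hp]; rfl)

/-- The map `lambdaMap` is smooth. -/
theorem lambdaMap_smooth (h : X → Y) (hh : DSmooth h) {x : X} {y : Y} (hxy : h x = y) {n : ℕ}
    {v : Eu n → LambdaAt Y y} (hv : IsPlot fun t => (⟨y, v t⟩ : Σ y, LambdaAt Y y)) :
    IsPlot fun t => (⟨x, lambdaMap h hh hxy (v t)⟩ : Σ x, LambdaAt X x) := by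
  intro u
  rcases hv u with ⟨_, ⟨q, hq, rfl⟩, e⟩ | ⟨z, e⟩
  · refine Or.inl ⟨_, ⟨fun t => (x, pullback h hh (q t).2), ?_, rfl⟩, ?_⟩
    · have hq2 : ∀ (k : ℕ) (p : Plot Y k), ContDiff ℝ ∞ fun z : Eu n × Eu k =>
          (q z.1).2.eval p z.2 := (DiffeologicalSpace.isPlot_inf_iff.1 hq).2
      exact DiffeologicalSpace.isPlot_inf_iff.2
        ⟨isPlot_const (x := x), fun n p => hq2 n (p.map h hh)⟩
    · filter_upwards [e] with t ht
      simp only [Function.comp_apply, Sigma.mk.injEq] at ht ⊢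
      obtain ⟨h1, h2⟩ := ht
      refine ⟨trivial, heq_of_eq ?_⟩
      generalize q t = z at *
      obtain ⟨z1, z2⟩ := z
      subst h1
      rw [eq_of_heq h2]
      rfl
  · refine Or.inr ⟨⟨x, lambdaMap h hh hxy (v u)⟩, ?_⟩
    have e0 := e.self_of_nhds
    filter_upwards [e] with t ht
    have : v t = v u := by
      have := ht.trans e0.symm
      simpa using this
    rw [this]

/-- The transpose `φ ↦ φ ∘ lambdaMap` between the diffeological duals of the fibres. -/
def lambdaDualMap (h : X → Y) (hh : DSmooth h) {x : X} {y : Y} (hxy : h x = y) :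
    smoothDual (LambdaAt X) x →ₗ[ℝ] smoothDual (LambdaAt Y) y :=
  (((lambdaMap h hh hxy).dualMap).comp (smoothDual (LambdaAt X) x).subtype).codRestrict
    (smoothDual (LambdaAt Y) y) fun φ n _ hv =>
      (smoothDual_contDiff _ φ (lambdaMap_smooth h hh hxy hv)).isPlot

/-- The form `τ(ρ ·, ρ ·)` on `Λ¹_y(Y)`, where `ρ = lambdaMap : Λ¹_y(Y) → Λ¹_x(X)` and
`τ ∈ Λ¹_x(X)* ⊗ Λ¹_x(X)*`. -/
def lambdaPull (h : X → Y) (hh : DSmooth h) {x : X} {y : Y} (hxy : h x = y)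
    (τ : DualTensorAt (LambdaAt X) x) : DualTensorAt (LambdaAt Y) y :=
  TensorProduct.map (lambdaDualMap h hh hxy) (lambdaDualMap h hh hxy) τ

theorem toBilin_lambdaPull (h : X → Y) (hh : DSmooth h) {x : X} {y : Y} (hxy : h x = y)
    (τ : DualTensorAt (LambdaAt X) x) (v w : LambdaAt Y y) :
    toBilin (lambdaPull h hh hxy τ) v w =
      toBilin τ (lambdaMap h hh hxy v) (lambdaMap h hh hxy w) := by
  induction τ using TensorProduct.induction_on with
  | zero => simp [lambdaPull]
  | tmul a b => simp only [lambdaPull, TensorProduct.map_tmul, toBilin_tmul]; rfl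
  | add a b ha hb => simp only [lambdaPull, map_add, LinearMap.add_apply] at ha hb ⊢; rw [ha, hb]

/-! ### Gluing -/

/-- `f : S → Y` is a diffeomorphism onto its image, for the subset diffeologies. -/
structure IsDiffeoOntoImage {S : Set X} (f : S → Y) : Prop where
  injective : Function.Injective f
  smooth : DSmooth f
  smooth_inverse : DSmooth (Equiv.ofInjective f injective).symm

variable {X₁ X₂ : Type*} [DiffeologicalSpace X₁] [DiffeologicalSpace X₂] {S : Set X₁}

/-- The relation `y ∼ f(y)`, `y ∈ S`, on the disjoint union of `X₁` and `X₂`. -/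
inductive GlueRel (f : S → X₂) : X₁ ⊕ X₂ → X₁ ⊕ X₂ → Prop
  | glue (y : S) : GlueRel f (Sum.inl y) (Sum.inr (f y))

/-- The glued space `X₁ ∪_f X₂`, the quotient of the disjoint union by the equivalence relation
generated by `y ∼ f(y)`. -/
def Glue (f : S → X₂) : Type _ := Quot (GlueRel f)

/-- The gluing diffeology. -/
instance glueDiffeology (f : S → X₂) : DiffeologicalSpace (Glue f) :=
  pushforwardDiffeology (Quot.mk (GlueRel f)) inferInstance

/-- The natural map `X₁ → X₁ ∪_f X₂`. -/
def inc₁ (f : S → X₂) (x : X₁) : Glue f := Quot.mk _ (Sum.inl x)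

/-- The natural map `X₂ → X₁ ∪_f X₂`. -/
def inc₂ (f : S → X₂) (x : X₂) : Glue f := Quot.mk _ (Sum.inr x)

theorem pushforward_smooth {A B : Type*} (h : A → B) (d : DiffeologicalSpace A) :
    @DSmooth A B d (pushforwardDiffeology h d) h :=
  fun _ p hp _ => Or.inl ⟨h ∘ p, ⟨p, hp, rfl⟩, EventuallyEq.rfl⟩

theorem inc₁_smooth (f : S → X₂) : DSmooth (inc₁ f) := fun n p hp =>
  pushforward_smooth (Quot.mk (GlueRel f)) _ n _
    fun _ => Or.inl ⟨_, Or.inl ⟨p, hp, rfl⟩, EventuallyEq.rfl⟩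

theorem inc₂_smooth (f : S → X₂) : DSmooth (inc₂ f) := fun n p hp =>
  pushforward_smooth (Quot.mk (GlueRel f)) _ n _
    fun _ => Or.inl ⟨_, Or.inr ⟨p, hp, rfl⟩, EventuallyEq.rfl⟩

theorem inc₂_apply (f : S → X₂) (y : S) : inc₁ f y = inc₂ f (f y) := Quot.sound (.glue y)

theorem subtype_val_smooth (S : Set X₁) : DSmooth (Subtype.val : S → X₁) := fun _ _ hp => hp

/-- The diffeology `𝒟₁^Ω` on `Ω¹(S)`: the pushforward of the diffeology of `Ω¹(X₁)` by the
pullback `i^*` by the inclusion `i` of `S` in `X₁`. -/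
@[reducible]
def omegaDiffeology₁ (S : Set X₁) : DiffeologicalSpace (Form S) :=
  pushforwardDiffeology (pullback (Subtype.val : S → X₁) (subtype_val_smooth S)) inferInstance

/-- The diffeology `𝒟₂^Ω` on `Ω¹(S)`: the pushforward of the diffeology of `Ω¹(X₂)` by the
pullback `f^*j^*` by `S → f(S) ⊆ X₂`. -/
@[reducible]
def omegaDiffeology₂ (f : S → X₂) (hf : DSmooth f) : DiffeologicalSpace (Form S) :=
  pushforwardDiffeology (pullback f hf) inferInstance

/-- Compatibility of `θ₁ ∈ Ω¹(X₁)` and `θ₂ ∈ Ω¹(X₂)`: `θ₁(p) = θ₂(f ∘ p)` for all plots `p` of the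
domain of gluing. -/
def CompatibleForms (f : S → X₂) (hf : DSmooth f) (θ₁ : Form X₁) (θ₂ : Form X₂) : Prop :=
  ∀ (n : ℕ) (p : Plot S n),
    θ₁.eval (p.map Subtype.val (subtype_val_smooth S)) = θ₂.eval (p.map f hf)

/-- Compatibility of `α₁ ∈ Λ¹_y(X₁)` and `α₂ ∈ Λ¹_{f(y)}(X₂)`: they are the values at `y` and
`f(y)` of two compatible forms. -/
def CompatibleValues (f : S → X₂) (hf : DSmooth f) (y : S) (α₁ : LambdaAt X₁ y)
    (α₂ : LambdaAt X₂ (f y)) : Prop :=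
  ∃ (θ₁ : Form X₁) (θ₂ : Form X₂), CompatibleForms f hf θ₁ θ₂ ∧
    θ₁.valueAt (y : X₁) = α₁ ∧ θ₂.valueAt (f y) = α₂

/-- Compatibility of pseudo-metrics on `Λ¹(X₁)` and `Λ¹(X₂)`. -/
def CompatibleMetrics (f : S → X₂) (hf : DSmooth f) (g₁ : ∀ x, DualTensorAt (LambdaAt X₁) x)
    (g₂ : ∀ x, DualTensorAt (LambdaAt X₂) x) : Prop :=
  ∀ (y : S) (α₁ β₁ : LambdaAt X₁ (y : X₁)) (α₂ β₂ : LambdaAt X₂ (f y)),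
    CompatibleValues f hf y α₁ α₂ → CompatibleValues f hf y β₁ β₂ →
    toBilin (g₁ y) α₁ β₁ = toBilin (g₂ (f y)) α₂ β₂

open Classical in
/-- The section `g^Λ` induced by `g₁` and `g₂`. At `x = i₁(x₁)` with `x₁ ∉ S` it is
`g₁(x₁)(ρ₁ ·, ρ₁ ·)`, at `x = i₂(x₂)` with `x₂ ∉ f(S)` it is `g₂(x₂)(ρ₂ ·, ρ₂ ·)`, and at
`x = i₂(f(y))` it is the average of `g₁(y)(ρ₁ ·, ρ₁ ·)` and `g₂(f(y))(ρ₂ ·, ρ₂ ·)`, where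
`ρ₁` and `ρ₂` are induced by restricting forms on `X₁ ∪_f X₂` to `X₁` and to `X₂`. For injective
`f`, exactly one of the three cases occurs, for exactly one `x₁`, `x₂`, or `y`. -/
def gluedMetric (f : S → X₂) (g₁ : ∀ x, DualTensorAt (LambdaAt X₁) x)
    (g₂ : ∀ x, DualTensorAt (LambdaAt X₂) x) (x : Glue f) : DualTensorAt (LambdaAt (Glue f)) x :=
  if h : ∃ x₁ : X₁, x₁ ∉ S ∧ inc₁ f x₁ = x then
    lambdaPull (inc₁ f) (inc₁_smooth f) h.choose_spec.2 (g₁ h.choose)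
  else if h : ∃ x₂ : X₂, x₂ ∉ Set.range f ∧ inc₂ f x₂ = x then
    lambdaPull (inc₂ f) (inc₂_smooth f) h.choose_spec.2 (g₂ h.choose)
  else if h : ∃ y : S, inc₂ f (f y) = x then
    (1 / 2 : ℝ) •
      (lambdaPull (inc₁ f) (inc₁_smooth f) ((inc₂_apply f h.choose).trans h.choose_spec)
          (g₁ h.choose) +
        lambdaPull (inc₂ f) (inc₂_smooth f) h.choose_spec (g₂ (f h.choose)))
  else 0

end GluedForms

end

open Diffeology GluedForms

noncomputable section

open Diffeology Topology Filter
open scoped ContDiff TensorProduct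

namespace GluedForms

/-! The averaging in the definition of the metric is only apparent. If `θ` is a form on the glued
space, its restrictions to `X₁` and `X₂` are compatible forms, so the values of `θ` at a point of
the gluing locus restrict to compatible pairs, on which `g₁` and `g₂` agree. Both halves of the
average therefore coincide, and the glued section is the pullback of `g₁` on all of `i₁(X₁)` and of
`g₂` on all of `i₂(X₂)` (`gluedMetric_inc₁`, `gluedMetric_inc₂`).

Smoothness is then local: a plot of the glued space lifts near each point to `X₁` or to `X₂`, and
there the section is `g₁` or `g₂` followed by the smooth pullback of tensors (`lambdaPull_smooth`).

For the rank, evaluations on plots are smooth functionals that separate the points of a fibre of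
`Λ¹`, so a finite-dimensional fibre has its full algebraic dual as smooth dual. The rank condition
thus means nondegeneracy, and a pseudo-metric on `Λ¹` is positive definite. A null covector of the
glued metric then has zero restrictions to `X₁` and `X₂`, and it vanishes because every plot through
the point lifts locally to one of the two (`Glue.lambda_eq_zero`). The same fact embeds each fibre
in a finite-dimensional space. -/

/-! ### Local nature of plots and of forms -/

/-- A map that locally agrees with plots is a plot. -/
theorem isPlot_of_eventuallyEq {X : Type*} [DiffeologicalSpace X] {n : ℕ} {p : Eu n → X}
    (hp : ∀ u, ∃ q : Eu n → X, IsPlot q ∧ p =ᶠ[𝓝 u] q) : IsPlot p := by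
  refine DiffeologicalSpace.locality fun u => ?_
  obtain ⟨q, hq, e⟩ := hp u
  obtain ⟨s, hs, hso, hus⟩ := eventually_nhds_iff.1 e
  refine ⟨s, hso, hus, fun {m h} hh hc => ?_⟩
  have : p ∘ h = q ∘ h := funext fun t => hs _ (hh t)
  rw [this]
  exact isPlot_reparam hq hc

section Forms

variable {X Y : Type*} [DiffeologicalSpace X] [DiffeologicalSpace Y]

/-- The value of `θ(p)` at `0` depends only on the germ of the plot `p`. -/
theorem Form.eval_zero_congr (θ : Form X) {n : ℕ} (p q : Plot X n) (e : p.1 =ᶠ[𝓝 0] q.1) :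
    θ.eval p 0 = θ.eval q 0 := by
  obtain ⟨s, hs, hso, hus⟩ := eventually_nhds_iff.1 e
  obtain ⟨r, hr, hrs, hru⟩ := exists_smooth_cutoff hso hus
  -- The cutoff `r` takes values where `p` and `q` agree, which turns equality of germs into
  -- equality of plots; being the identity near `0`, it has identity derivative there and does not
  -- change the value at `0`.
  have hpq : p.reparam r hr = q.reparam r hr := Subtype.ext (funext fun t => hs _ (hrs t))
  have key : ∀ p' : Plot X n, θ.eval (p'.reparam r hr) 0 = θ.eval p' 0 := fun p' => by
    have hd : fderiv ℝ r 0 = ContinuousLinearMap.id ℝ (Eu n) :=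
      (EventuallyEq.fderiv_eq (f := id) hru).trans fderiv_id
    have h := θ.isForm.compat n n p' r hr 0
    rw [hd, hru.self_of_nhds, ContinuousLinearMap.comp_id] at h
    exact h
  rw [← key p, ← key q, hpq]

theorem Form.valueAt_surjective (x : X) :
    Function.Surjective fun θ : Form X => θ.valueAt x :=
  Submodule.mkQ_surjective _

theorem Form.valueAt_eq_zero {θ : Form X} {x : X} :
    θ.valueAt x = 0 ↔ ∀ (n : ℕ) (p : Plot X n), p.1 0 = x → θ.eval p 0 = 0 :=
  Submodule.Quotient.mk_eq_zero _

theorem lambdaMap_valueAt (h : X → Y) (hh : DSmooth h) {x : X} {y : Y} (hxy : h x = y)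
    (θ : Form Y) : lambdaMap h hh hxy (θ.valueAt y) = (pullback h hh θ).valueAt x := rfl

/-- The map `(x, θ) ↦ (x, θ_x)` is smooth. -/
theorem isPlot_valueAt {n : ℕ} {x : Eu n → X} {q : Eu n → Form X} (hx : IsPlot x)
    (hq : IsPlot q) : IsPlot fun t => (⟨x t, (q t).valueAt (x t)⟩ : Σ x, LambdaAt X x) :=
  fun _ => Or.inl ⟨_, ⟨fun t => (x t, q t), DiffeologicalSpace.isPlot_inf_iff.2 ⟨hx, hq⟩, rfl⟩,
    EventuallyEq.rfl⟩

/-- The plots of `Λ¹(X)` are locally given by plots of `X` and of `Ω¹(X)`. -/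
theorem exists_eventuallyEq_valueAt {n : ℕ} {v : Eu n → Σ x, LambdaAt X x} (hv : IsPlot v)
    (u : Eu n) : ∃ (x : Eu n → X) (q : Eu n → Form X), IsPlot x ∧ IsPlot q ∧
      ∀ᶠ t in 𝓝 u, v t = ⟨x t, (q t).valueAt (x t)⟩ := by
  rcases hv u with ⟨_, ⟨q, hq, rfl⟩, e⟩ | ⟨⟨x, α⟩, e⟩
  · obtain ⟨h1, h2⟩ := DiffeologicalSpace.isPlot_inf_iff.1 hq
    exact ⟨fun t => (q t).1, fun t => (q t).2, h1, h2, e⟩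
  · obtain ⟨θ, rfl⟩ := Form.valueAt_surjective x α
    exact ⟨fun _ => x, fun _ => θ, isPlot_const, isPlot_const, e⟩

/-- Restriction along `h` sends the plots of `Λ¹(Y)` over `h ∘ x` to plots of `Λ¹(X)`. -/
theorem isPlot_lambdaMap (h : X → Y) (hh : DSmooth h) {n : ℕ} {x : Eu n → X} (hx : IsPlot x)
    {v : ∀ t, LambdaAt Y (h (x t))} (hv : IsPlot fun t => (⟨h (x t), v t⟩ : Σ y, LambdaAt Y y)) :
    IsPlot fun t => (⟨x t, lambdaMap h hh rfl (v t)⟩ : Σ x, LambdaAt X x) := by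
  refine isPlot_of_eventuallyEq fun u => ?_
  -- Only the forms `q` are kept: the base plot `y` agrees with `h ∘ x` near `u`, so the given lift
  -- `x` can serve as base for the pulled-back forms.
  obtain ⟨y, q, -, hq, e⟩ := exists_eventuallyEq_valueAt hv u
  refine ⟨_, isPlot_valueAt hx (q := fun t => pullback h hh (q t))
    (fun n p => hq n (p.map h hh)), ?_⟩
  filter_upwards [e] with t ht
  rw [Sigma.mk.injEq] at ht
  obtain ⟨h1, h2⟩ := ht
  generalize y t = z at h1 h2
  subst h1
  rw [eq_of_heq h2, lambdaMap_valueAt]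

/-! ### Duals of the fibres of `Λ¹` -/

/-- The functional `θ_x ↦ θ(p)(0)(e)` on `Λ¹_x(X)` for a plot `p` centered at `x`. -/
def evalFunctional {x : X} {n : ℕ} (p : Plot X n) (hp : p.1 0 = x) (e : Eu n) :
    Module.Dual ℝ (LambdaAt X x) :=
  (vanishingForms X x).liftQ
    { toFun := fun θ => θ.eval p 0 e
      map_add' := fun _ _ => rfl
      map_smul' := fun _ _ => rfl } fun θ hθ => by
    change θ.eval p 0 e = 0
    rw [show θ.eval p 0 = 0 from hθ n p hp]
    rfl

theorem evalFunctional_valueAt {x : X} {n : ℕ} (p : Plot X n) (hp : p.1 0 = x) (e : Eu n)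
    (θ : Form X) : evalFunctional p hp e (θ.valueAt x) = θ.eval p 0 e := rfl

/-- A plot of the fibre is locally the class of a plot `q` of forms, and `t ↦ q(t)(p)(0)(e)` is
smooth by the definition of the functional diffeology. -/
theorem evalFunctional_mem_smoothDual {x : X} {n : ℕ} (p : Plot X n) (hp : p.1 0 = x)
    (e : Eu n) : evalFunctional p hp e ∈ smoothDual (LambdaAt X) x := by
  intro m v hv
  refine ContDiff.isPlot (contDiff_iff_contDiffAt.2 fun u => ?_)
  obtain ⟨y, q, -, hq, ev⟩ := exists_eventuallyEq_valueAt (v := Sigma.mk x ∘ v) hv u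
  have hc : ContDiff ℝ ∞ fun t => (q t).eval p 0 e :=
    ((hq n p).comp (contDiff_id.prodMk contDiff_const)).clm_apply contDiff_const
  refine hc.contDiffAt.congr_of_eventuallyEq ?_
  filter_upwards [ev] with t ht
  rw [Function.comp_apply, Sigma.mk.injEq] at ht
  obtain ⟨h1, h2⟩ := ht
  generalize y t = z at h1 h2
  subst h1
  rw [Function.comp_apply, eq_of_heq h2, evalFunctional_valueAt]

/-- The smooth functionals on `Λ¹_x(X)` separate points; in finite dimensions, all functionals
are therefore smooth. -/
theorem smoothDual_lambdaAt_eq_top (x : X) [FiniteDimensional ℝ (LambdaAt X x)] :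
    smoothDual (LambdaAt X) x = ⊤ := by
  have h : (smoothDual (LambdaAt X) x).dualCoannihilator = ⊥ := by
    rw [Submodule.eq_bot_iff]
    intro α hα
    rw [Submodule.mem_dualCoannihilator] at hα
    obtain ⟨θ, rfl⟩ := Form.valueAt_surjective x α
    refine Form.valueAt_eq_zero.2 fun n p hp => ContinuousLinearMap.ext fun e => ?_
    exact hα _ (evalFunctional_mem_smoothDual p hp e)
  -- In finite dimensions a space of functionals is the annihilator of its common kernel, here zero.
  rw [← Subspace.dualCoannihilator_dualAnnihilator_eq (W := smoothDual (LambdaAt X) x), h,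
    Submodule.dualAnnihilator_bot]

/-- Turns the rank required of a pseudo-metric into the full dimension of the fibre. -/
theorem finrank_smoothDual_lambdaAt (x : X) [FiniteDimensional ℝ (LambdaAt X x)] :
    Module.finrank ℝ (smoothDual (LambdaAt X) x) = Module.finrank ℝ (LambdaAt X x) := by
  rw [smoothDual_lambdaAt_eq_top, finrank_top, Subspace.dual_finrank_eq]

/-- A pseudo-metric on `Λ¹(X)` is positive definite on the fibres. -/
theorem IsPseudoMetric.eq_zero {κ : TensorKind} {g : ∀ x, DualTensorAt (LambdaAt X) x}
    (hg : IsPseudoMetric κ g) {x : X} {α : LambdaAt X x} (hα : toBilin (g x) α α = 0) :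
    α = 0 := by
  have := hg.finite_dim x
  have hr := LinearMap.finrank_range_add_finrank_ker (toBilin (g x))
  rw [hg.rank_eq, finrank_smoothDual_lambdaAt, Nat.add_eq_left,
    Submodule.finrank_eq_zero] at hr
  -- By Cauchy–Schwarz a null vector lies in the radical, which rank–nullity has just shown to be
  -- zero.
  have hm : α ∈ LinearMap.ker (toBilin (g x)) := by
    refine LinearMap.mem_ker.2 (LinearMap.ext fun β => ?_)
    have hle := LinearMap.BilinForm.apply_mul_apply_le_of_forall_zero_le (toBilin (g x))
      (hg.nonneg x) α β
    rw [hα, zero_mul, hg.symm x β α] at hle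
    exact mul_self_eq_zero.1 (le_antisymm hle (mul_self_nonneg _))
  rwa [hr, Submodule.mem_bot] at hm

/-- A positive definite form on a finite-dimensional fibre of `Λ¹(X)` has the rank of a
pseudo-metric. -/
theorem finrank_range_toBilin {x : X} [FiniteDimensional ℝ (LambdaAt X x)]
    (τ : DualTensorAt (LambdaAt X) x) (hτ : ∀ α, toBilin τ α α = 0 → α = 0) :
    Module.finrank ℝ (LinearMap.range (toBilin τ)) =
      Module.finrank ℝ (smoothDual (LambdaAt X) x) := by
  rw [finrank_smoothDual_lambdaAt]
  refine LinearMap.finrank_range_of_inj ((injective_iff_map_eq_zero _).2 fun α hα => hτ α ?_)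
  rw [hα, LinearMap.zero_apply]

end Forms

/-- On finite-dimensional fibres, an element of `(V x)* ⊗ (V x)*` is determined by its bilinear
form. -/
theorem toBilin_injective {X : Type*} [DiffeologicalSpace X] (V : X → Type*)
    [∀ x, AddCommGroup (V x)] [∀ x, Module ℝ (V x)] [DiffeologicalSpace (Σ x, V x)] (x : X)
    [FiniteDimensional ℝ (V x)] :
    Function.Injective (toBilin : DualTensorAt V x →ₗ[ℝ] _) := by
  -- `toBilin` factors through the tensor square of the algebraic dual: the first map is injective
  -- by flatness over a field, the second is an isomorphism in finite dimensions.
  have h : (toBilin : DualTensorAt V x →ₗ[ℝ] _) =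
      dualTensorHom ℝ (V x) (Module.Dual ℝ (V x)) ∘ₗ
        TensorProduct.map (smoothDual V x).subtype (smoothDual V x).subtype := by
    ext a b v w
    exact toBilin_tmul a b v w
  have : Module.Free ℝ (smoothDual V x) := Module.Free.of_divisionRing ℝ (smoothDual V x)
  have : Module.Flat ℝ (smoothDual V x) := Module.Flat.of_free
  rw [h, LinearMap.coe_comp]
  exact (dualTensorHomEquiv ℝ (V x) (Module.Dual ℝ (V x))).injective.comp
    (TensorProduct.map_injective_of_flat_flat _ _ (Submodule.subtype_injective _)
      (Submodule.subtype_injective _))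

/-! ### Smoothness of the transposes of restrictions -/

section Pull

variable {X Y : Type*} [DiffeologicalSpace X] [DiffeologicalSpace Y]

/-- Evaluating the transpose on a plot over `h ∘ x` is evaluating `a` on its restriction, which is a
plot over `x` by `isPlot_lambdaMap`. -/
theorem isPlot_lambdaDualMap (h : X → Y) (hh : DSmooth h) {n : ℕ} {x : Eu n → X}
    {a : ∀ u, smoothDual (LambdaAt X) (x u)}
    (ha : IsPlot fun u => (⟨x u, a u⟩ : Σ x, smoothDual (LambdaAt X) x)) :
    IsPlot fun u =>
      (⟨h (x u), lambdaDualMap h hh rfl (a u)⟩ : Σ y, smoothDual (LambdaAt Y) y) :=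
  ⟨hh n x ha.1, fun m k hk _ hv =>
    ha.2 m k hk _ (isPlot_lambdaMap h hh (isPlot_reparam ha.1 hk) hv)⟩

/-- The map `(x, τ) ↦ (h x, τ(ρ ·, ρ ·))`, where `ρ` is the restriction along `h`, is smooth. -/
theorem lambdaPull_smooth (h : X → Y) (hh : DSmooth h) (κ : TensorKind) :
    @DSmooth _ _ (dualTensorDiffeology (LambdaAt X) κ) (dualTensorDiffeology (LambdaAt Y) κ)
      fun z : Σ x, DualTensorAt (LambdaAt X) x =>
        (⟨h z.1, lambdaPull h hh rfl z.2⟩ : Σ y, DualTensorAt (LambdaAt Y) y) := by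
  intro n τ hτ
  cases κ with
  | tensor =>
    intro u
    rcases hτ u with ⟨_, ⟨x, k, a, b, hx, ha, hb, rfl⟩, e⟩ | ⟨z, e⟩
    · refine Or.inl ⟨_, ⟨h ∘ x, k, fun i u => lambdaDualMap h hh rfl (a i u),
        fun i u => lambdaDualMap h hh rfl (b i u), hh n x hx,
        fun i => isPlot_lambdaDualMap h hh (ha i), fun i => isPlot_lambdaDualMap h hh (hb i),
        rfl⟩, ?_⟩
      filter_upwards [e] with t ht
      rw [Function.comp_apply, ht]
      simp [lambdaPull]
    · exact Or.inr ⟨_, e.fun_comp fun z : Σ x, DualTensorAt (LambdaAt X) x =>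
        (⟨h z.1, lambdaPull h hh rfl z.2⟩ : Σ y, DualTensorAt (LambdaAt Y) y)⟩
  | functional =>
    refine ⟨hh n _ hτ.1, fun m k hk v w hv hw => ?_⟩
    have hx := isPlot_reparam hτ.1 hk
    simp only [Function.comp_apply, toBilin_lambdaPull]
    exact hτ.2 m k hk _ _ (isPlot_lambdaMap h hh hx hv) (isPlot_lambdaMap h hh hx hw)

end Pull

/-! ### Points of the glued space -/

section Points

variable {X₁ X₂ : Type*} {S : Set X₁} {f : S → X₂}

open Classical in
/-- The representative of a point of `X₁ ∪_f X₂` in `X₁ ⊔ X₂` that lies in `X₂` if possible. -/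
def Glue.repr (f : S → X₂) : Glue f → X₁ ⊕ X₂ :=
  Quot.lift (Sum.elim (fun x => if h : x ∈ S then Sum.inr (f ⟨x, h⟩) else Sum.inl x) Sum.inr) <| by
    rintro _ _ ⟨y⟩
    simp

open Classical in
theorem Glue.repr_inc₁ (x : X₁) :
    Glue.repr f (inc₁ f x) = if h : x ∈ S then Sum.inr (f ⟨x, h⟩) else Sum.inl x := rfl

theorem Glue.repr_inc₂ (x : X₂) : Glue.repr f (inc₂ f x) = Sum.inr x := rfl

/-- `Glue.repr` recovers every point of `X₂`; comparing representatives avoids analysing the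
generated equivalence relation. -/
theorem inc₂_injective : Function.Injective (inc₂ f) := fun x x' h => by
  simpa [Glue.repr_inc₂] using congrArg (Glue.repr f) h

/-- Points outside `S` represent themselves, points of `S` are represented by their images under
`f`, and the two kinds land in different summands. -/
theorem inc₁_injective (hf : Function.Injective f) : Function.Injective (inc₁ f) :=
  fun x x' h => by
    have h := congrArg (Glue.repr f) h
    rw [Glue.repr_inc₁, Glue.repr_inc₁] at h
    split_ifs at h with h1 h2
    · exact congrArg Subtype.val (hf (Sum.inr_injective h))
    · exact Sum.inl_injective h

theorem exists_of_inc₁_eq_inc₂ {x₁ : X₁} {x₂ : X₂} (h : inc₁ f x₁ = inc₂ f x₂) :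
    ∃ y : S, y = x₁ ∧ f y = x₂ := by
  have h := congrArg (Glue.repr f) h
  rw [Glue.repr_inc₁, Glue.repr_inc₂] at h
  split_ifs at h with h1
  exact ⟨⟨x₁, h1⟩, rfl, Sum.inr_injective h⟩

theorem Glue.cases (x : Glue f) : (∃ x₁, inc₁ f x₁ = x) ∨ ∃ x₂, inc₂ f x₂ = x := by
  obtain ⟨z, rfl⟩ := Quot.exists_rep x
  cases z with
  | inl x₁ => exact Or.inl ⟨x₁, rfl⟩
  | inr x₂ => exact Or.inr ⟨x₂, rfl⟩

end Points

/-! ### Plots and covectors of the glued space -/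

section Gluing

variable {X₁ X₂ : Type*} [DiffeologicalSpace X₁] [DiffeologicalSpace X₂] {S : Set X₁}
  {f : S → X₂}

/-- The plots of `X₁ ∪_f X₂` lift locally to `X₁` or to `X₂`. -/
theorem Glue.exists_local_lift {n : ℕ} {p : Eu n → Glue f} (hp : IsPlot p) (u : Eu n) :
    (∃ q : Eu n → X₁, IsPlot q ∧ p =ᶠ[𝓝 u] inc₁ f ∘ q) ∨
      ∃ q : Eu n → X₂, IsPlot q ∧ p =ᶠ[𝓝 u] inc₂ f ∘ q := by
  -- Constant germs are allowed both by the pushforward and by the disjoint union diffeology, so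
  -- this case arises twice below.
  have hconst : ∀ x : Glue f, (p =ᶠ[𝓝 u] fun _ => x) →
      (∃ q : Eu n → X₁, IsPlot q ∧ p =ᶠ[𝓝 u] inc₁ f ∘ q) ∨
        ∃ q : Eu n → X₂, IsPlot q ∧ p =ᶠ[𝓝 u] inc₂ f ∘ q := by
    intro x e
    rcases Glue.cases x with ⟨x, rfl⟩ | ⟨x, rfl⟩
    · exact Or.inl ⟨fun _ => x, isPlot_const, e⟩
    · exact Or.inr ⟨fun _ => x, isPlot_const, e⟩
  rcases hp u with ⟨_, ⟨q, hq, rfl⟩, e⟩ | ⟨x, e⟩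
  · rcases hq u with ⟨_, ⟨r, hr, rfl⟩ | ⟨r, hr, rfl⟩, e'⟩ | ⟨z, e'⟩
    · exact Or.inl ⟨r, hr, e.trans (e'.fun_comp _)⟩
    · exact Or.inr ⟨r, hr, e.trans (e'.fun_comp _)⟩
    · exact hconst _ (e.trans (e'.fun_comp _))
  · exact hconst x e

/-- An element of `Λ¹_x(X₁ ∪_f X₂)` is determined by its restrictions to `X₁` and `X₂`. -/
theorem Glue.lambda_eq_zero {x : Glue f} {α : LambdaAt (Glue f) x}
    (h₁ : ∀ (x₁ : X₁) (h : inc₁ f x₁ = x), lambdaMap (inc₁ f) (inc₁_smooth f) h α = 0)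
    (h₂ : ∀ (x₂ : X₂) (h : inc₂ f x₂ = x), lambdaMap (inc₂ f) (inc₂_smooth f) h α = 0) :
    α = 0 := by
  obtain ⟨θ, rfl⟩ := Form.valueAt_surjective x α
  refine Form.valueAt_eq_zero.2 fun n p hp => ?_
  -- The value at `0` sees only the germ of `p`, which factors through a plot `q` of one piece;
  -- there it is a value of the restricted form at `q 0`, a point over `x`.
  rcases Glue.exists_local_lift p.2 0 with ⟨q, hq, e⟩ | ⟨q, hq, e⟩
  · rw [θ.eval_zero_congr p (Plot.map ⟨q, hq⟩ (inc₁ f) (inc₁_smooth f)) e]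
    exact Form.valueAt_eq_zero.1 (h₁ (q 0) (e.self_of_nhds.symm.trans hp)) n ⟨q, hq⟩ rfl
  · rw [θ.eval_zero_congr p (Plot.map ⟨q, hq⟩ (inc₂ f) (inc₂_smooth f)) e]
    exact Form.valueAt_eq_zero.1 (h₂ (q 0) (e.self_of_nhds.symm.trans hp)) n ⟨q, hq⟩ rfl

/-- A covector is determined by its restrictions to the preimages of `x`, and there is at most one
preimage in each piece. Products over the sets of preimages treat zero and one preimage uniformly.
-/
theorem Glue.finiteDimensional_lambdaAt (hf : Function.Injective f)
    [∀ x, FiniteDimensional ℝ (LambdaAt X₁ x)] [∀ x, FiniteDimensional ℝ (LambdaAt X₂ x)]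
    (x : Glue f) : FiniteDimensional ℝ (LambdaAt (Glue f) x) := by
  have : Subsingleton {x₁ // inc₁ f x₁ = x} :=
    ⟨fun a b => Subtype.ext (inc₁_injective hf (a.2.trans b.2.symm))⟩
  have : Subsingleton {x₂ // inc₂ f x₂ = x} :=
    ⟨fun a b => Subtype.ext (inc₂_injective (a.2.trans b.2.symm))⟩
  let L₁ : LambdaAt (Glue f) x →ₗ[ℝ] ∀ a : {x₁ // inc₁ f x₁ = x}, LambdaAt X₁ a.1 :=
    LinearMap.pi fun a => lambdaMap (inc₁ f) (inc₁_smooth f) a.2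
  let L₂ : LambdaAt (Glue f) x →ₗ[ℝ] ∀ a : {x₂ // inc₂ f x₂ = x}, LambdaAt X₂ a.1 :=
    LinearMap.pi fun a => lambdaMap (inc₂ f) (inc₂_smooth f) a.2
  refine Module.Finite.of_injective (L₁.prod L₂) ((injective_iff_map_eq_zero _).2 fun α hα => ?_)
  obtain ⟨hα₁, hα₂⟩ := Prod.mk.inj hα
  exact Glue.lambda_eq_zero (fun x₁ h => congrFun hα₁ ⟨x₁, h⟩) fun x₂ h => congrFun hα₂ ⟨x₂, h⟩

/-- The restrictions of an element of `Λ¹_{f(y)}(X₁ ∪_f X₂)` to `X₁` and `X₂` are compatible. -/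
theorem compatibleValues_lambdaMap (hf : DSmooth f) (y : S) {x : Glue f} (h₁ : inc₁ f y = x)
    (h₂ : inc₂ f (f y) = x) (α : LambdaAt (Glue f) x) :
    CompatibleValues f hf y (lambdaMap (inc₁ f) (inc₁_smooth f) h₁ α)
      (lambdaMap (inc₂ f) (inc₂_smooth f) h₂ α) := by
  obtain ⟨θ, rfl⟩ := Form.valueAt_surjective x α
  refine ⟨_, _, fun n p => ?_, (lambdaMap_valueAt ..).symm, (lambdaMap_valueAt ..).symm⟩
  -- Both restrictions evaluate `θ` on the same plot, since `i₁ ∘ p = i₂ ∘ f ∘ p` for a plot `p` of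
  -- `S`.
  exact congrArg (fun q : Plot (Glue f) n => θ.eval q)
    (Subtype.ext (funext fun t => inc₂_apply f (p.1 t)))

/-! ### The induced metric -/

/-- Replaces the point chosen in `gluedMetric` by a given one, although the proof of `h x = y`
depends on that point. -/
theorem lambdaPull_congr {X Y : Type*} [DiffeologicalSpace X] [DiffeologicalSpace Y] (h : X → Y)
    (hh : DSmooth h) (g : ∀ x, DualTensorAt (LambdaAt X) x) {x x' : X} {y : Y} (hx : h x = y)
    (hx' : h x' = y) (e : x = x') :
    lambdaPull h hh hx (g x) = lambdaPull h hh hx' (g x') := by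
  subst e
  rfl

variable {g₁ : ∀ x, DualTensorAt (LambdaAt X₁) x} {g₂ : ∀ x, DualTensorAt (LambdaAt X₂) x}

/-- For compatible metrics, the two pullbacks to a fibre over the domain of gluing agree. -/
theorem CompatibleMetrics.lambdaPull_eq (hf : DSmooth f) (hg : CompatibleMetrics f hf g₁ g₂)
    (y : S) {x : Glue f} (h₁ : inc₁ f y = x) (h₂ : inc₂ f (f y) = x)
    [FiniteDimensional ℝ (LambdaAt (Glue f) x)] :
    lambdaPull (inc₁ f) (inc₁_smooth f) h₁ (g₁ y) =
      lambdaPull (inc₂ f) (inc₂_smooth f) h₂ (g₂ (f y)) := by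
  -- Compatibility only compares bilinear forms; the definition of the section and the tensor
  -- product diffeology require equality of the tensors themselves.
  refine toBilin_injective _ x (LinearMap.ext₂ fun α β => ?_)
  rw [toBilin_lambdaPull, toBilin_lambdaPull]
  exact hg y _ _ _ _ (compatibleValues_lambdaMap hf y h₁ h₂ α)
    (compatibleValues_lambdaMap hf y h₁ h₂ β)

/-- Injectivity of `inc₁` forces the choice made in the definition; the next two lemmas settle the
other cases likewise. -/
theorem gluedMetric_of_notMem (hf : Function.Injective f) {x₁ : X₁} (hx₁ : x₁ ∉ S) {x : Glue f}
    (h : inc₁ f x₁ = x) :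
    gluedMetric f g₁ g₂ x = lambdaPull (inc₁ f) (inc₁_smooth f) h (g₁ x₁) := by
  have hex : ∃ x₁ : X₁, x₁ ∉ S ∧ inc₁ f x₁ = x := ⟨x₁, hx₁, h⟩
  rw [gluedMetric, dif_pos hex]
  exact lambdaPull_congr _ _ g₁ _ _ (inc₁_injective hf (hex.choose_spec.2.trans h.symm))

theorem gluedMetric_of_notMem_range {x₂ : X₂} (hx₂ : x₂ ∉ Set.range f) {x : Glue f}
    (h : inc₂ f x₂ = x) :
    gluedMetric f g₁ g₂ x = lambdaPull (inc₂ f) (inc₂_smooth f) h (g₂ x₂) := by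
  have hnot : ¬ ∃ x₁ : X₁, x₁ ∉ S ∧ inc₁ f x₁ = x := by
    rintro ⟨x₁, -, h'⟩
    obtain ⟨y, -, hy⟩ := exists_of_inc₁_eq_inc₂ (h'.trans h.symm)
    exact hx₂ ⟨y, hy⟩
  have hex : ∃ x₂ : X₂, x₂ ∉ Set.range f ∧ inc₂ f x₂ = x := ⟨x₂, hx₂, h⟩
  rw [gluedMetric, dif_neg hnot, dif_pos hex]
  exact lambdaPull_congr _ _ g₂ _ _ (inc₂_injective (hex.choose_spec.2.trans h.symm))

theorem gluedMetric_of_mem (hf : Function.Injective f) (y : S) {x : Glue f}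
    (h₁ : inc₁ f y = x) (h₂ : inc₂ f (f y) = x) :
    gluedMetric f g₁ g₂ x = (1 / 2 : ℝ) •
      (lambdaPull (inc₁ f) (inc₁_smooth f) h₁ (g₁ y) +
        lambdaPull (inc₂ f) (inc₂_smooth f) h₂ (g₂ (f y))) := by
  have hnot₁ : ¬ ∃ x₁ : X₁, x₁ ∉ S ∧ inc₁ f x₁ = x := by
    rintro ⟨x₁, hx₁, h'⟩
    exact hx₁ (inc₁_injective hf (h'.trans h₁.symm) ▸ y.2)
  have hnot₂ : ¬ ∃ x₂ : X₂, x₂ ∉ Set.range f ∧ inc₂ f x₂ = x := by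
    rintro ⟨x₂, hx₂, h'⟩
    exact hx₂ ⟨y, (inc₂_injective (h'.trans h₂.symm)).symm⟩
  have hex : ∃ y : S, inc₂ f (f y) = x := ⟨y, h₂⟩
  rw [gluedMetric, dif_neg hnot₁, dif_neg hnot₂, dif_pos hex]
  have hy : hex.choose = y := hf (inc₂_injective (hex.choose_spec.trans h₂.symm))
  congr 2
  · exact lambdaPull_congr _ _ g₁ _ _ (congrArg Subtype.val hy)
  · exact lambdaPull_congr _ _ g₂ _ _ (congrArg f hy)

/-- For compatible metrics, the induced metric is the pullback of `g₂` at all points of `X₂`. -/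
theorem gluedMetric_inc₂ (hf : Function.Injective f) (hs : DSmooth f)
    (hg : CompatibleMetrics f hs g₁ g₂) (x₂ : X₂) {x : Glue f} (h : inc₂ f x₂ = x)
    [FiniteDimensional ℝ (LambdaAt (Glue f) x)] :
    gluedMetric f g₁ g₂ x = lambdaPull (inc₂ f) (inc₂_smooth f) h (g₂ x₂) := by
  by_cases hx₂ : x₂ ∈ Set.range f
  · obtain ⟨y, rfl⟩ := hx₂
    have h₁ : inc₁ f y = x := (inc₂_apply f y).trans h
    rw [gluedMetric_of_mem hf y h₁ h, hg.lambdaPull_eq hs y h₁ h, ← two_smul ℝ, smul_smul]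
    norm_num
  · exact gluedMetric_of_notMem_range hx₂ h

/-- For compatible metrics, the induced metric is the pullback of `g₁` at all points of `X₁`. -/
theorem gluedMetric_inc₁ (hf : Function.Injective f) (hs : DSmooth f)
    (hg : CompatibleMetrics f hs g₁ g₂) (x₁ : X₁) {x : Glue f} (h : inc₁ f x₁ = x)
    [FiniteDimensional ℝ (LambdaAt (Glue f) x)] :
    gluedMetric f g₁ g₂ x = lambdaPull (inc₁ f) (inc₁_smooth f) h (g₁ x₁) := by
  by_cases hx₁ : x₁ ∈ S
  · have h₂ : inc₂ f (f ⟨x₁, hx₁⟩) = x := (inc₂_apply f ⟨x₁, hx₁⟩).symm.trans h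
    rw [gluedMetric_inc₂ hf hs hg _ h₂]
    exact (hg.lambdaPull_eq hs ⟨x₁, hx₁⟩ h h₂).symm
  · exact gluedMetric_of_notMem hf hx₁ h

/-- The section induced by compatible pseudo-metrics is a pseudo-metric. -/
theorem isPseudoMetric_gluedMetric {κ : TensorKind} (hf : Function.Injective f) (hs : DSmooth f)
    (hg₁ : IsPseudoMetric κ g₁) (hg₂ : IsPseudoMetric κ g₂)
    (hg : CompatibleMetrics f hs g₁ g₂) : IsPseudoMetric κ (gluedMetric f g₁ g₂) := by
  have := hg₁.finite_dim
  have := hg₂.finite_dim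
  have hfin := Glue.finiteDimensional_lambdaAt hf
  have e₁ : ∀ (x₁ : X₁) {x : Glue f} (h : inc₁ f x₁ = x) (α β : LambdaAt (Glue f) x),
      toBilin (gluedMetric f g₁ g₂ x) α β = toBilin (g₁ x₁)
        (lambdaMap (inc₁ f) (inc₁_smooth f) h α) (lambdaMap (inc₁ f) (inc₁_smooth f) h β) :=
    fun x₁ x h α β => by rw [gluedMetric_inc₁ hf hs hg x₁ h, toBilin_lambdaPull]
  have e₂ : ∀ (x₂ : X₂) {x : Glue f} (h : inc₂ f x₂ = x) (α β : LambdaAt (Glue f) x),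
      toBilin (gluedMetric f g₁ g₂ x) α β = toBilin (g₂ x₂)
        (lambdaMap (inc₂ f) (inc₂_smooth f) h α) (lambdaMap (inc₂ f) (inc₂_smooth f) h β) :=
    fun x₂ x h α β => by rw [gluedMetric_inc₂ hf hs hg x₂ h, toBilin_lambdaPull]
  refine ⟨hfin, fun n p hp => ?_, fun x α β => ?_, fun x α => ?_,
    fun x => finrank_range_toBilin _ fun α hα => Glue.lambda_eq_zero (fun x₁ h => ?_)
      fun x₂ h => ?_⟩
  -- Selects the diffeology of kind `κ` as the instance for the local criterion.
  · let _ := dualTensorDiffeology (LambdaAt (Glue f)) κ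
    refine isPlot_of_eventuallyEq fun u => ?_
    rcases Glue.exists_local_lift hp u with ⟨q, hq, e⟩ | ⟨q, hq, e⟩
    · refine ⟨_, lambdaPull_smooth (inc₁ f) (inc₁_smooth f) κ n _ (hg₁.smooth n q hq), ?_⟩
      filter_upwards [e] with t ht
      refine (congrArg (fun x => (⟨x, gluedMetric f g₁ g₂ x⟩ :
        Σ x, DualTensorAt (LambdaAt (Glue f)) x)) ht).trans ?_
      exact congrArg (Sigma.mk _) (gluedMetric_inc₁ hf hs hg (q t) rfl)
    · refine ⟨_, lambdaPull_smooth (inc₂ f) (inc₂_smooth f) κ n _ (hg₂.smooth n q hq), ?_⟩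
      filter_upwards [e] with t ht
      refine (congrArg (fun x => (⟨x, gluedMetric f g₁ g₂ x⟩ :
        Σ x, DualTensorAt (LambdaAt (Glue f)) x)) ht).trans ?_
      exact congrArg (Sigma.mk _) (gluedMetric_inc₂ hf hs hg (q t) rfl)
  · rcases Glue.cases x with ⟨x₁, h⟩ | ⟨x₂, h⟩
    · rw [e₁ x₁ h, e₁ x₁ h, hg₁.symm]
    · rw [e₂ x₂ h, e₂ x₂ h, hg₂.symm]
  · rcases Glue.cases x with ⟨x₁, h⟩ | ⟨x₂, h⟩
    · rw [e₁ x₁ h]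
      exact hg₁.nonneg _ _
    · rw [e₂ x₂ h]
      exact hg₂.nonneg _ _
  -- The restriction of a null covector is null for `g₁`, which is definite.
  · exact hg₁.eq_zero ((e₁ x₁ h α α).symm.trans hα)
  · exact hg₂.eq_zero ((e₂ x₂ h α α).symm.trans hα)

end Gluing

end GluedForms

end

theorem mainTheorem4 {X₁ X₂ : Type*} [DiffeologicalSpace X₁] [DiffeologicalSpace X₂]
    (Y : Set X₁) (f : Y → X₂) (hf : IsDiffeoOntoImage f)
    (hD : omegaDiffeology₁ Y = omegaDiffeology₂ f hf.smooth) (κ : TensorKind) :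
    (∀ (g₁ : ∀ x, DualTensorAt (LambdaAt X₁) x) (g₂ : ∀ x, DualTensorAt (LambdaAt X₂) x),
      IsPseudoMetric κ g₁ → IsPseudoMetric κ g₂ → CompatibleMetrics f hf.smooth g₁ g₂ →
        IsPseudoMetric κ (gluedMetric f g₁ g₂)) ∧
    ((∃ (g₁ : ∀ x, DualTensorAt (LambdaAt X₁) x) (g₂ : ∀ x, DualTensorAt (LambdaAt X₂) x),
      IsPseudoMetric κ g₁ ∧ IsPseudoMetric κ g₂ ∧ CompatibleMetrics f hf.smooth g₁ g₂) →
        ∃ g : ∀ x, DualTensorAt (LambdaAt (Glue f)) x, IsPseudoMetric κ g) := by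
  have key : ∀ (g₁ : ∀ x, DualTensorAt (LambdaAt X₁) x) (g₂ : ∀ x, DualTensorAt (LambdaAt X₂) x),
      IsPseudoMetric κ g₁ → IsPseudoMetric κ g₂ → CompatibleMetrics f hf.smooth g₁ g₂ →
        IsPseudoMetric κ (gluedMetric f g₁ g₂) :=
    fun _ _ hg₁ hg₂ hg => isPseudoMetric_gluedMetric hf.injective hf.smooth hg₁ hg₂ hg
  exact ⟨key, fun ⟨g₁, g₂, hg₁, hg₂, hg⟩ => ⟨_, key g₁ g₂ hg₁ hg₂ hg⟩⟩
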